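/- Let $S\subset\mathbb N$ be an infinite set of natural numbers, and for $N\in\mathbb N$ let $S_N=\{n\in S: n\le N\}$. Suppose that for every $k\in\mathbb N$ $$\limsup_{N\to\infty}\frac{|S_N|}{(\log N)^k}=\infty .$$ Then there exists a real-valued function $f\in L^1([0,1))$ (with respect to Lebesgue measure) such that the averages $$A_Nf(x)=\frac1{|S_N|}\sum_{n\in S_N}f(nx \bmod 1)$$ satisfy $\limsup_{N\to\infty}A_Nf(x)=\infty$ for Lebesgue-almost every $x\in[0,1)$. -/

import Mathlib

open MeasureTheory Filter Set

noncomputable section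

open Classical in
/-- The finite set `S_N = {n ∈ S : n ≤ N}`. -/
def truncSet (S : Set ℕ) (N : ℕ) : Finset ℕ :=
  (Finset.range (N + 1)).filter (fun n => n ∈ S)

theorem mem_truncSet {S : Set ℕ} {N n : ℕ} : n ∈ truncSet S N ↔ n ∈ S ∧ n ≤ N := by
  simp [truncSet, and_comm]

/-- The average `A_N f(x) = (1/|S_N|) ∑_{n ∈ S_N} f(nx mod 1)` of a function `f` on `[0,1)`
(only the values of `f` on `[0,1)` are used). -/
def khinchinAvg (S : Set ℕ) (f : ℝ → ℝ) (N : ℕ) (x : ℝ) : ℝ :=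
  (1 / ((truncSet S N).card : ℝ)) * ∑ n ∈ truncSet S N, f (Int.fract ((n : ℝ) * x))

end

/-! The averages fail every weak type (1,1) bound, and the failure is spread over the circle by
independence. Since `|S_{2^k}|` is not polynomially bounded in `k`, some dyadic scale has
arbitrarily many cells on which it doubles (`exists_doubling_cells`); at the end of such a cell at
least half of `S_N` lies in the cell. A multiplicatively Følner box of divisors gives sets `X`, `E`
with `|X|` at least about `|K| |E| / 5`, where each `γ ∈ X` has a cell all of whose `n` satisfy `γ /
n ∈ E` (`exists_division_sets`). If `γx` lies in a short interval `A`, then `nx` lies in the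
preimage of `A` under multiplication by `γ / n`. The preimages of `A` under the elements of `X` are
disjoint, so a set of measure `|X| |A|` has averages at least 1/2 of the indicator of a set of
measure at most `|E| |A|` (`exists_weak_type_failure`).

Composing with successive dilations by `K` gives independent copies covering all but measure
`2^{-j}`, at cost `|F_j| ≤ 4^{-j}` (`exists_small_set_halfVisits`). The function `∑ 2^j 1_{F_j}` is
integrable, and Borel–Cantelli finishes. -/

/-! ### Doubling cells from superpolynomial growth. -/

/-- If, at every dyadic scale, a monotone sequence increases by more than `1` on a bounded number
of cells only, then it grows at most logarithmically. -/
theorem dyadic_growth_bound (G : ℕ → ℝ) (hG : Monotone G) (B : ℕ → Finset ℕ) (M : ℕ)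
    (hM : ∀ r, (B r).card ≤ M)
    (hB : ∀ r k, k ∉ B r → G ((k + 1) * 2 ^ r) - G (k * 2 ^ r) ≤ 1) :
    ∃ c : ℝ, ∀ R : ℕ, G (2 ^ R) ≤ c + 2 * M * R := by
  set Φ : ℕ → ℕ → ℝ := fun r k => G ((k + 1) * 2 ^ r) - G (k * 2 ^ r) with hΦ
  have hpos : ∀ r k, 0 ≤ Φ r k := fun r k =>
    sub_nonneg.2 (hG (Nat.mul_le_mul_right _ (Nat.le_succ k)))
  have hsplit : ∀ r k, Φ (r + 1) k = Φ r (2 * k) + Φ r (2 * k + 1) := by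
    intro r k
    have h1 : (k + 1) * 2 ^ (r + 1) = (2 * k + 1 + 1) * 2 ^ r := by ring
    have h2 : k * 2 ^ (r + 1) = (2 * k) * 2 ^ r := by ring
    simp only [hΦ, h1, h2]
    ring
  have hstep : ∀ r, ∑ k ∈ B (r + 1), Φ (r + 1) k ≤ (∑ k ∈ B r, Φ r k) + 2 * M := by
    intro r
    have key : ∀ C : Finset ℕ, ∑ c ∈ C, Φ r c ≤ (∑ c ∈ C ∩ B r, Φ r c) + (C \ B r).card := by
      intro C
      rw [← Finset.sum_inter_add_sum_sdiff C (B r)]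
      gcongr
      calc ∑ c ∈ C \ B r, Φ r c ≤ ∑ c ∈ C \ B r, (1 : ℝ) :=
            Finset.sum_le_sum fun c hc => hB r c (Finset.mem_sdiff.1 hc).2
        _ = _ := by simp
    -- The halves of the exceptional cells: at most `2M`, each either exceptional at scale `r` or
    -- contributing at most 1.
    let C : Finset ℕ := (B (r + 1)).image (fun k => 2 * k) ∪ (B (r + 1)).image (fun k => 2 * k + 1)
    have hdisj : Disjoint ((B (r + 1)).image (fun k => 2 * k))
        ((B (r + 1)).image (fun k => 2 * k + 1)) := by
      rw [Finset.disjoint_left]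
      intro a ha hb
      simp only [Finset.mem_image] at ha hb
      obtain ⟨x, -, hx⟩ := ha
      obtain ⟨y, -, hy⟩ := hb
      omega
    have hsum : ∑ k ∈ B (r + 1), Φ (r + 1) k = ∑ c ∈ C, Φ r c := by
      rw [Finset.sum_union hdisj, Finset.sum_image (by intro a _ b _ h; simpa using h),
        Finset.sum_image (by intro a _ b _ h; simpa using h), ← Finset.sum_add_distrib]
      exact Finset.sum_congr rfl fun k _ => hsplit r k
    have hcard : (C.card : ℝ) ≤ 2 * M := by
      have : C.card ≤ 2 * M := by
        refine (Finset.card_union_le _ _).trans ?_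
        have h1 := Finset.card_image_le (s := B (r + 1)) (f := fun k => 2 * k)
        have h2 := Finset.card_image_le (s := B (r + 1)) (f := fun k => 2 * k + 1)
        have := hM (r + 1)
        omega
      exact_mod_cast this
    rw [hsum]
    refine (key C).trans ?_
    have h1 : ∑ c ∈ C ∩ B r, Φ r c ≤ ∑ c ∈ B r, Φ r c :=
      Finset.sum_le_sum_of_subset_of_nonneg Finset.inter_subset_right fun i _ _ => hpos r i
    have h2 : ((C \ B r).card : ℝ) ≤ C.card := by
      exact_mod_cast Finset.card_le_card Finset.sdiff_subset
    linarith
  have hall : ∀ R : ℕ, ∑ k ∈ B R, Φ R k ≤ (∑ k ∈ B 0, Φ 0 k) + 2 * M * R := by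
    intro R
    induction R with
    | zero => simp
    | succ n ih =>
      have := hstep n
      push_cast
      linarith
  refine ⟨G 0 + 1 + ∑ k ∈ B 0, Φ 0 k, fun R => ?_⟩
  have h0 : Φ R 0 ≤ 1 + ∑ k ∈ B R, Φ R k := by
    by_cases h : 0 ∈ B R
    · have := Finset.single_le_sum (f := Φ R) (fun i _ => hpos R i) h
      linarith
    · have h1 := hB R 0 h
      have h2 : 0 ≤ ∑ k ∈ B R, Φ R k := Finset.sum_nonneg fun i _ => hpos R i
      exact (show Φ R 0 ≤ 1 from h1).trans (by linarith)
  have h1 : Φ R 0 = G (2 ^ R) - G 0 := by simp [hΦ]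
  have := hall R
  linarith

/-- A monotone sequence of natural numbers that is not polynomially bounded doubles on arbitrarily
many cells of a suitable dyadic scale. -/
theorem exists_doubling_cells (g : ℕ → ℕ) (hg : Monotone g)
    (hgrow : ∀ (d : ℕ) (c : ℝ), ∃ n : ℕ, 1 ≤ n ∧ c * (n : ℝ) ^ d < g n) (M T : ℕ) :
    ∃ (r : ℕ) (K : Finset ℕ), K.card = M ∧
      ∀ k ∈ K, T ≤ k * 2 ^ r ∧ 2 * g (k * 2 ^ r) ≤ g ((k + 1) * 2 ^ r) := by
  classical
  by_contra hcon
  push Not at hcon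
  set bad : ℕ → Set ℕ := fun r => {k | 2 * g (k * 2 ^ r) ≤ g ((k + 1) * 2 ^ r)} with hbad
  -- Since `k ≤ k * 2 ^ r`, only the `T` indices below `T` can violate the threshold.
  have hfin : ∀ r (F : Finset ℕ), (F : Set ℕ) ⊆ bad r → F.card ≤ M + T := by
    intro r F hF
    by_contra! hlt
    have h1 : M ≤ (F \ Finset.range T).card := by
      have := Finset.le_card_sdiff (Finset.range T) F
      simp at this
      omega
    obtain ⟨K, hK, hKc⟩ := Finset.exists_subset_card_eq h1
    obtain ⟨k, hk, h⟩ := hcon r K hKc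
    have hk' := Finset.mem_sdiff.1 (hK hk)
    have hkT : T ≤ k := by simpa using hk'.2
    have h2 : k ≤ k * 2 ^ r := Nat.le_mul_of_pos_right _ (by positivity)
    have h3 := hF hk'.1
    have h4 := h (hkT.trans h2)
    simp only [hbad, mem_ofPred_eq] at h3
    omega
  have hbf : ∀ r, (bad r).Finite := by
    intro r
    by_contra hinf
    obtain ⟨F, hF, hc⟩ := (show (bad r).Infinite from hinf).exists_subset_card_eq (M + T + 1)
    have := hfin r F hF
    omega
  -- The shift by 1 avoids `log 0`, and a non-doubling cell still raises the logarithm by at most 1.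
  obtain ⟨c, hc⟩ := dyadic_growth_bound (fun n => Real.logb 2 (g n + 1))
    (fun a b hab => Real.logb_le_logb_of_le (by norm_num) (by positivity)
      (by have := hg hab; gcongr))
    (fun r => (hbf r).toFinset) (M + T) (fun r => hfin r _ (by simp)) (by
      intro r k hk
      simp only [Finite.mem_toFinset, hbad, mem_ofPred_eq, not_le] at hk
      have h1 : (g ((k + 1) * 2 ^ r) : ℝ) + 1 ≤ 2 * (g (k * 2 ^ r) + 1) := by
        have : g ((k + 1) * 2 ^ r) + 1 ≤ 2 * (g (k * 2 ^ r) + 1) := by omega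
        exact_mod_cast this
      have h2 : Real.logb 2 (g ((k + 1) * 2 ^ r) + 1) ≤ Real.logb 2 (2 * (g (k * 2 ^ r) + 1)) :=
        Real.logb_le_logb_of_le (by norm_num) (by positivity) h1
      rw [Real.logb_mul (by norm_num) (by positivity), Real.logb_self_eq_one (by norm_num)] at h2
      linarith)
  set d := 2 * (M + T) with hd
  obtain ⟨n, hn1, hn⟩ := hgrow d (2 ^ c * 2 ^ d)
  set R := Nat.clog 2 n with hR
  have hnR : n ≤ 2 ^ R := Nat.le_pow_clog (by norm_num) n
  have hRn : (2 : ℝ) ^ R ≤ 2 * n := by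
    rcases Nat.eq_zero_or_pos R with h | h
    · rw [h]
      have : (1 : ℝ) ≤ n := by exact_mod_cast hn1
      simp; linarith
    · have hn2 : 1 < n := by
        by_contra h'
        have : n = 1 := by omega
        simp [hR, this] at h
      have h1 := Nat.pow_pred_clog_lt_self (by norm_num : 1 < 2) hn2
      have h2 : 2 ^ R = 2 * 2 ^ (R - 1) := by
        rw [← pow_succ']; congr 1; omega
      have h3 : 2 ^ R ≤ 2 * n := by
        rw [h2]
        exact Nat.mul_le_mul_left _ h1.le
      exact_mod_cast h3
  have h1 := hc R
  have h2 : (g (2 ^ R) : ℝ) + 1 ≤ 2 ^ (c + 2 * ((M + T : ℕ) : ℝ) * R) := by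
    rwa [Real.logb_le_iff_le_rpow (by norm_num) (by positivity)] at h1
  have h3 : (2 : ℝ) ^ (c + 2 * ((M + T : ℕ) : ℝ) * R) = 2 ^ c * (2 ^ R) ^ d := by
    rw [Real.rpow_add (by norm_num), ← pow_mul, ← Real.rpow_natCast]
    congr 2
    push_cast [hd]
    ring
  have h4 : ((2 : ℝ) ^ R) ^ d ≤ (2 * n) ^ d := by gcongr
  have h5 : (g n : ℝ) ≤ g (2 ^ R) := by exact_mod_cast hg hnR
  have h6 : (2 : ℝ) ^ c * (2 ^ R) ^ d ≤ 2 ^ c * (2 * n) ^ d := by gcongr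
  rw [mul_pow] at h6
  nlinarith

/-- A hypothesis on the limit superior against powers of the logarithm, restated along powers
of two. -/
theorem truncSet_two_pow_growth (S : Set ℕ)
    (hgrowth : ∀ k : ℕ,
      limsup (fun N : ℕ =>
        ((((truncSet S N).card : ℝ) / (Real.log (N : ℝ)) ^ k : ℝ) : EReal)) atTop = ⊤)
    (d : ℕ) (c : ℝ) :
    ∃ n : ℕ, 1 ≤ n ∧ c * (n : ℝ) ^ d < (truncSet S (2 ^ n)).card := by
  have h1 : ((max c 0 * 3 ^ d : ℝ) : EReal) < limsup (fun N : ℕ =>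
        ((((truncSet S N).card : ℝ) / (Real.log (N : ℝ)) ^ d : ℝ) : EReal)) atTop := by
    rw [hgrowth d]; exact EReal.coe_lt_top _
  obtain ⟨N, hN, hN3⟩ := ((frequently_lt_of_lt_limsup (by isBoundedDefault) h1).and_eventually
    (eventually_ge_atTop 3)).exists
  rw [EReal.coe_lt_coe_iff] at hN
  have hN3' : (3 : ℝ) ≤ N := by exact_mod_cast hN3
  have hlog : 1 ≤ Real.log N := by
    rw [Real.le_log_iff_exp_le (by linarith)]
    linarith [Real.exp_one_lt_d9]
  refine ⟨Nat.clog 2 N, Nat.clog_pos (by norm_num) (by omega), ?_⟩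
  have hle : N ≤ 2 ^ Nat.clog 2 N := Nat.le_pow_clog (by norm_num) N
  have hn : ((Nat.clog 2 N : ℕ) : ℝ) ≤ 3 * Real.log N := by
    have h2 := Nat.pow_pred_clog_lt_self (by norm_num : 1 < 2) (show 1 < N by omega)
    have hp : 0 < Nat.clog 2 N := Nat.clog_pos (by norm_num) (by omega)
    have h3 : ((2 : ℝ) ^ (Nat.clog 2 N - 1)) ≤ N := by exact_mod_cast h2.le
    have h4 := Real.log_le_log (by positivity) h3
    rw [Real.log_pow, Nat.cast_sub (by omega)] at h4
    have := Real.log_two_gt_d9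
    push_cast at h4
    nlinarith
  have hcard : ((truncSet S N).card : ℝ) ≤ (truncSet S (2 ^ Nat.clog 2 N)).card := by
    have : truncSet S N ⊆ truncSet S (2 ^ Nat.clog 2 N) := fun x hx => by
      rw [mem_truncSet] at hx ⊢
      exact ⟨hx.1, hx.2.trans hle⟩
    exact_mod_cast Finset.card_le_card this
  rw [lt_div_iff₀ (by positivity)] at hN
  calc c * ((Nat.clog 2 N : ℕ) : ℝ) ^ d ≤ max c 0 * (3 * Real.log N) ^ d := by
        gcongr
        exact le_max_left _ _
    _ = max c 0 * 3 ^ d * Real.log N ^ d := by rw [mul_pow]; ring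
    _ < _ := hN.trans_le hcard

/-! ### Multiplicative boxes and division into a short window. -/

/-- The number of divisors of `L ^ R` grows subexponentially in `R`. -/
theorem exists_card_divisors_pow_succ_le (L : ℕ) (hL : L ≠ 0) :
    ∃ R : ℕ, (L ^ (R + 1)).divisors.card ≤ 2 * (L ^ R).divisors.card := by
  set s := L.primeFactors.card with hs
  -- With `R = n + 1`, each of the `s` factors `R * e + 1` of the divisor count grows by a ratio at
  -- most `1 + 1 / R` from `R` to `R + 1`.
  have hlim : Tendsto (fun n : ℕ => (1 + 1 / ((n : ℝ) + 1)) ^ s) atTop (nhds ((1 + 0) ^ s)) :=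
    (tendsto_const_nhds.add tendsto_one_div_add_atTop_nhds_zero_nat).pow s
  have hev := hlim.eventually (gt_mem_nhds (show (1 + 0 : ℝ) ^ s < 2 by norm_num))
  obtain ⟨n, hn⟩ := hev.exists
  refine ⟨n + 1, ?_⟩
  have hcard : ∀ R : ℕ, R ≠ 0 → (L ^ R).divisors.card
      = ∏ p ∈ L.primeFactors, (R * L.factorization p + 1) := by
    intro R hR
    rw [Nat.card_divisors (pow_ne_zero _ hL), Nat.primeFactors_pow _ hR]
    simp [Nat.factorization_pow]
  rw [hcard _ (by omega), hcard _ (by omega)]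
  have hle : ((∏ p ∈ L.primeFactors, ((n + 1 + 1) * L.factorization p + 1) : ℕ) : ℝ)
      ≤ (1 + 1 / ((n : ℝ) + 1)) ^ s *
        (∏ p ∈ L.primeFactors, ((n + 1) * L.factorization p + 1) : ℕ) := by
    rw [hs, ← Finset.prod_const]
    push_cast
    rw [← Finset.prod_mul_distrib]
    refine Finset.prod_le_prod (fun i _ => by positivity) fun i _ => ?_
    have : (0 : ℝ) < n + 1 := by positivity
    have h1 : (1 + 1 / ((n : ℝ) + 1)) * ((n + 1) * L.factorization i + 1)
        = (n + 1 + 1) * L.factorization i + 1 + 1 / ((n : ℝ) + 1) := by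
      field_simp
      ring
    rw [h1]
    have : 0 ≤ 1 / ((n : ℝ) + 1) := by positivity
    linarith
  have h2 : (1 + 1 / ((n : ℝ) + 1)) ^ s *
        (∏ p ∈ L.primeFactors, ((n + 1) * L.factorization p + 1) : ℕ) ≤
        2 * (∏ p ∈ L.primeFactors, ((n + 1) * L.factorization p + 1) : ℕ) := by gcongr
  exact_mod_cast hle.trans h2

/-- A pair of finite sets of positive integers `X`, `E` with `X` much larger than `E`, such that
every element of `X` is moved into `E` by division by all integers of one of the given
geometric cells. -/
theorem exists_division_sets (w : ℕ) (hw : 1 ≤ w) (K : Finset ℕ) (hK : K.Nonempty) :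
    ∃ X E : Finset ℕ, (∀ γ ∈ X, 0 < γ) ∧ (∀ δ ∈ E, 0 < δ) ∧ K.card * E.card < 5 * X.card ∧
      ∀ γ ∈ X, ∃ k ∈ K, ∀ n, 2 ^ (k * w) < n → n ≤ 2 ^ ((k + 1) * w) → n ∣ γ ∧ γ / n ∈ E := by
  classical
  set b := 2 ^ w with hb
  have hb1 : 1 < b := Nat.one_lt_two_pow (by omega)
  have hpow : ∀ k, 2 ^ (k * w) = b ^ k := fun k => by rw [hb, ← pow_mul, mul_comm]
  simp only [hpow]
  set kmax := K.sup id with hkmax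
  have hkle : ∀ k ∈ K, k ≤ kmax := fun k hk => Finset.le_sup (f := id) hk
  -- Every `n` in every cell divides `L`, so dividing a multiple of `L` in the box by `n` stays in
  -- the box.
  set L := (b ^ (kmax + 1)).factorial with hL
  have hL0 : L ≠ 0 := Nat.factorial_ne_zero _
  have hLge : b ^ (kmax + 1) ≤ L := Nat.self_le_factorial _
  obtain ⟨R, hR⟩ := exists_card_divisors_pow_succ_le L hL0
  set B := (L ^ (R + 1)).divisors with hB
  set B' := (L ^ R).divisors.image (fun x => L * x) with hB'
  have hB'c : B'.card = (L ^ R).divisors.card :=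
    Finset.card_image_of_injective _ fun x y h => Nat.eq_of_mul_eq_mul_left (by omega) h
  have hBpos : ∀ γ ∈ B, 0 < γ := fun γ h => Nat.pos_of_mem_divisors h
  have hB'B : ∀ γ ∈ B', γ ∈ B ∧ L ∣ γ := by
    intro γ h
    obtain ⟨x, hx, rfl⟩ := Finset.mem_image.1 h
    refine ⟨Nat.mem_divisors.2 ⟨?_, pow_ne_zero _ hL0⟩, dvd_mul_right _ _⟩
    rw [pow_succ']
    exact mul_dvd_mul_left _ (Nat.dvd_of_mem_divisors hx)
  have hB'pos : 0 < B'.card := by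
    rw [hB'c]
    exact Finset.card_pos.2 ⟨1, Nat.one_mem_divisors.2 (pow_ne_zero _ hL0)⟩
  set ℓ : ℕ → ℕ := fun γ => Nat.log b γ with hℓ
  have hℓB' : ∀ γ ∈ B', kmax + 1 ≤ ℓ γ := by
    intro γ h
    obtain ⟨h1, h2⟩ := hB'B γ h
    exact Nat.le_log_of_pow_le hb1 (hLge.trans (Nat.le_of_dvd (hBpos γ h1) h2))
  set H := B.sup ℓ + 1 with hH
  have hℓH : ∀ γ ∈ B, ℓ γ < H := fun γ h => Nat.lt_succ_of_le (Finset.le_sup h)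
  -- Dividing by `n ∈ (b^k, b^(k+1)]` lowers the base-`b` logarithm from `a + k + 1` to `a` or `a +
  -- 1`. The offset `a` is found by averaging.
  set E : ℕ → Finset ℕ := fun a => B.filter (fun δ => ℓ δ = a ∨ ℓ δ = a + 1) with hE
  set X : ℕ → Finset ℕ := fun a => B'.filter (fun γ => ∃ k ∈ K, ℓ γ = a + k + 1) with hX
  have hEsum : ∑ a ∈ Finset.range H, (E a).card ≤ 2 * B.card := by
    have := Finset.sum_card_bipartiteAbove_eq_sum_card_bipartiteBelow
      (s := Finset.range H) (t := B) (fun a δ => ℓ δ = a ∨ ℓ δ = a + 1)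
    simp only [Finset.bipartiteAbove, Finset.bipartiteBelow] at this
    rw [hE, this, mul_comm]
    refine Finset.sum_le_card_nsmul _ _ _ fun δ _ => ?_
    refine (Finset.card_le_card (t := {ℓ δ, ℓ δ - 1}) fun a ha => ?_).trans Finset.card_le_two
    have := (Finset.mem_filter.1 ha).2
    simp only [Finset.mem_insert, Finset.mem_singleton]
    omega
  have hXsum : K.card * B'.card ≤ ∑ a ∈ Finset.range H, (X a).card := by
    have := Finset.sum_card_bipartiteAbove_eq_sum_card_bipartiteBelow
      (s := Finset.range H) (t := B') (fun a γ => ∃ k ∈ K, ℓ γ = a + k + 1)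
    simp only [Finset.bipartiteAbove, Finset.bipartiteBelow] at this
    rw [hX, this, mul_comm]
    refine Finset.card_nsmul_le_sum _ _ _ fun γ hγ => ?_
    have h1 := hℓB' γ hγ
    have h2 := hℓH γ (hB'B γ hγ).1
    have hinj : Set.InjOn (fun k => ℓ γ - k - 1) K := by
      intro x hx y hy hxy
      have := hkle x hx
      have := hkle y hy
      simp only at hxy
      omega
    rw [← Finset.card_image_of_injOn hinj]
    refine Finset.card_le_card fun a ha => ?_
    obtain ⟨k, hk, rfl⟩ := Finset.mem_image.1 ha
    have := hkle k hk
    exact Finset.mem_filter.2 ⟨Finset.mem_range.2 (by omega), k, hk, by omega⟩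
  -- Each `δ` is counted at most twice and `|B| ≤ 2|B'|`, whence the factor 4 < 5.
  have hsum : ∑ a ∈ Finset.range H, K.card * (E a).card
      < ∑ a ∈ Finset.range H, 5 * (X a).card := by
    rw [← Finset.mul_sum, ← Finset.mul_sum]
    have h1 : B.card ≤ 2 * B'.card := by rw [hB'c]; exact hR
    have h2 : 0 < K.card * B'.card := Nat.mul_pos (Finset.card_pos.2 hK) hB'pos
    have h3 := Nat.mul_le_mul_left K.card (hEsum.trans (Nat.mul_le_mul_left 2 h1))
    nlinarith
  obtain ⟨a, -, ha⟩ := Finset.exists_lt_of_sum_lt hsum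
  refine ⟨X a, E a, fun γ h => hBpos γ (hB'B γ (Finset.mem_filter.1 h).1).1,
    fun δ h => hBpos δ (Finset.mem_filter.1 h).1, ha, fun γ hγ => ?_⟩
  obtain ⟨hγB', k, hk, hγk⟩ := Finset.mem_filter.1 hγ
  obtain ⟨hγB, hLγ⟩ := hB'B γ hγB'
  refine ⟨k, hk, fun n hn1 hn2 => ?_⟩
  have hn0 : 0 < n := by omega
  have hnL : n ∣ L := by
    refine Nat.dvd_factorial hn0 (hn2.trans (Nat.pow_le_pow_right (by omega) ?_))
    have := hkle k hk
    omega
  have hnγ : n ∣ γ := hnL.trans hLγ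
  refine ⟨hnγ, Finset.mem_filter.2 ⟨?_, ?_⟩⟩
  · exact Nat.mem_divisors.2 ⟨(Nat.div_dvd_of_dvd hnγ).trans (Nat.dvd_of_mem_divisors hγB),
      pow_ne_zero _ hL0⟩
  · obtain ⟨q, rfl⟩ := hnγ
    have hq0 : q ≠ 0 := by
      rintro rfl
      exact absurd (hBpos _ hγB) (by simp)
    rw [Nat.mul_div_cancel_left _ hn0]
    have hlow : b ^ (a + k + 1) ≤ n * q := hγk ▸ Nat.pow_log_le_self b (hBpos _ hγB).ne'
    have hhigh : n * q < b ^ (a + k + 1 + 1) := hγk ▸ Nat.lt_pow_succ_log_self hb1 (n * q)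
    have h1 : b ^ a ≤ q := by
      by_contra! h
      have : n * q < b ^ (k + 1) * b ^ a := by
        calc n * q ≤ b ^ (k + 1) * q := Nat.mul_le_mul_right _ hn2
          _ < _ := Nat.mul_lt_mul_of_pos_left h (by positivity)
      rw [← pow_add, show k + 1 + a = a + k + 1 by ring] at this
      omega
    have h2 : q < b ^ (a + 2) := by
      by_contra! h
      have : b ^ k * b ^ (a + 2) ≤ n * q := Nat.mul_le_mul hn1.le h
      rw [← pow_add, show k + (a + 2) = a + k + 1 + 1 by ring] at this
      omega
    have h3 : a ≤ Nat.log b q := Nat.le_log_of_pow_le hb1 h1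
    have h4 : Nat.log b q < a + 2 := Nat.log_lt_of_lt_pow hq0 h2
    simp only [hℓ]
    omega

/-! ### Dilations of the circle and independence. -/

/-- Multiplication by `n` modulo `1`, on representatives in `[0,1)`. -/
noncomputable def dil (n : ℕ) (x : ℝ) : ℝ := Int.fract ((n : ℝ) * x)

theorem dil_dil (m n : ℕ) (x : ℝ) : dil m (dil n x) = dil (m * n) x := by
  simp only [dil]
  rw [Int.fract_eq_fract]
  refine ⟨-(m * ⌊(n : ℝ) * x⌋), ?_⟩
  rw [Int.fract]
  push_cast
  ring

theorem dil_comm (m n : ℕ) (x : ℝ) : dil m (dil n x) = dil n (dil m x) := by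
  rw [dil_dil, dil_dil, mul_comm]

theorem measurable_dil (n : ℕ) : Measurable (dil n) :=
  measurable_fract.comp (measurable_const.mul measurable_id)

/-- Lebesgue measure on `[0,1)`. -/
noncomputable def unitVol : Measure ℝ := volume.restrict (Ico (0 : ℝ) 1)

instance : IsProbabilityMeasure unitVol := ⟨by simp [unitVol]⟩

theorem measurableSet_cells (K : ℕ) (p : Set ℤ) : MeasurableSet {x : ℝ | ⌊(K : ℝ) * x⌋ ∈ p} :=
  (Int.measurable_floor.comp (measurable_const.mul measurable_id)) (MeasurableSet.of_discrete)

open Classical in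
/-- Inside each cell `[i/K,(i+1)/K)` the map `x ↦ Kx mod 1` is affine onto `[0,1)`. -/
theorem unitVol_cells_inter_preimage_dil (K : ℕ) (hK : 1 ≤ K) (p : Set ℤ) (Z : Set ℝ)
    (hZ : MeasurableSet Z) :
    unitVol ({x : ℝ | ⌊(K : ℝ) * x⌋ ∈ p} ∩ dil K ⁻¹' Z)
      = ((Finset.range K).filter (fun i : ℕ => (i : ℤ) ∈ p)).card *
        (ENNReal.ofReal (K : ℝ)⁻¹ * unitVol Z) := by
  have hK0 : (0 : ℝ) < K := by exact_mod_cast hK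
  have hset : ({x : ℝ | ⌊(K : ℝ) * x⌋ ∈ p} ∩ dil K ⁻¹' Z) ∩ Ico 0 1 =
      ⋃ i ∈ (Finset.range K).filter (fun i : ℕ => (i : ℤ) ∈ p),
        (fun x : ℝ => (K : ℝ) * x) ⁻¹' ((fun y : ℝ => y + (-(i : ℝ))) ⁻¹' (Z ∩ Ico 0 1)) := by
    ext x
    simp only [mem_inter_iff, mem_ofPred_eq, mem_preimage, mem_Ico, mem_iUnion, Finset.mem_filter,
      Finset.mem_range, exists_prop]
    constructor
    · rintro ⟨⟨hp, hz⟩, hx0, hx1⟩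
      have h0 : 0 ≤ ⌊(K : ℝ) * x⌋ := Int.floor_nonneg.2 (by positivity)
      obtain ⟨i, hi⟩ := Int.eq_ofNat_of_zero_le h0
      have hiK : (i : ℝ) < K := by
        have h1 := Int.floor_le ((K : ℝ) * x)
        rw [hi] at h1
        push_cast at h1
        nlinarith
      have hfr : (K : ℝ) * x + -(i : ℝ) = Int.fract ((K : ℝ) * x) := by
        rw [Int.fract, hi]; push_cast; ring
      refine ⟨i, ⟨by exact_mod_cast hiK, hi ▸ hp⟩, ?_, ?_, ?_⟩
      · rw [hfr]; exact hz
      · rw [hfr]; exact Int.fract_nonneg _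
      · rw [hfr]; exact Int.fract_lt_one _
    · rintro ⟨i, ⟨hiK, hp⟩, hz, h0, h1⟩
      have hfl : ⌊(K : ℝ) * x⌋ = (i : ℤ) := by
        rw [Int.floor_eq_iff]
        push_cast
        constructor <;> linarith
      have hi0 : (0 : ℝ) ≤ i := by positivity
      have hiK' : (i : ℝ) + 1 ≤ K := by exact_mod_cast hiK
      refine ⟨⟨hfl ▸ hp, ?_⟩, ?_, ?_⟩
      · rw [dil, Int.fract, hfl]
        push_cast
        simpa [sub_eq_add_neg] using hz
      · by_contra! h
        nlinarith
      · by_contra! h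
        nlinarith
  have hmeas : MeasurableSet (Z ∩ Ico (0 : ℝ) 1) := hZ.inter measurableSet_Ico
  rw [unitVol, Measure.restrict_apply' measurableSet_Ico,
    Measure.restrict_apply' measurableSet_Ico, hset, measure_biUnion_finset]
  · rw [← nsmul_eq_mul, ← Finset.sum_const]
    refine Finset.sum_congr rfl fun i _ => ?_
    rw [Real.volume_preimage_mul_left hK0.ne', measure_preimage_add_right,
      abs_of_pos (inv_pos.2 hK0)]
  · intro i _ j _ hij
    rw [Function.onFun, Set.disjoint_left]
    rintro x ⟨-, hi0, hi1⟩ ⟨-, hj0, hj1⟩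
    apply hij
    have h1 : (i : ℝ) < j + 1 := by linarith
    have h2 : (j : ℝ) < i + 1 := by linarith
    have h1' : i < j + 1 := by exact_mod_cast h1
    have h2' : j < i + 1 := by exact_mod_cast h2
    omega
  · intro i _
    exact (measurable_const.mul measurable_id) ((measurable_id.add_const _) hmeas)

theorem unitVol_preimage_dil (K : ℕ) (hK : 1 ≤ K) (Z : Set ℝ) (hZ : MeasurableSet Z) :
    unitVol (dil K ⁻¹' Z) = unitVol Z := by
  classical
  have h := unitVol_cells_inter_preimage_dil K hK univ Z hZ
  have hK0 : (0 : ℝ) < K := by exact_mod_cast hK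
  have h1 : {x : ℝ | ⌊(K : ℝ) * x⌋ ∈ (univ : Set ℤ)} = univ := by ext; simp
  rw [h1, univ_inter] at h
  rw [h, ← mul_assoc, ENNReal.ofReal_inv_of_pos hK0, ENNReal.ofReal_natCast]
  simp only [mem_univ, Finset.filter_true, Finset.card_range]
  rw [ENNReal.mul_inv_cancel (by exact_mod_cast (by omega : K ≠ 0)) (ENNReal.natCast_ne_top K),
    one_mul]

/-- A union of cells of length `1/K` is independent of every preimage under `x ↦ Kx mod 1`. -/
theorem unitVol_cells_indep (K : ℕ) (hK : 1 ≤ K) (p : Set ℤ) (Z : Set ℝ) (hZ : MeasurableSet Z) :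
    unitVol ({x : ℝ | ⌊(K : ℝ) * x⌋ ∈ p} ∩ dil K ⁻¹' Z)
      = unitVol {x : ℝ | ⌊(K : ℝ) * x⌋ ∈ p} * unitVol Z := by
  classical
  have h := unitVol_cells_inter_preimage_dil K hK p univ MeasurableSet.univ
  rw [preimage_univ, inter_univ, measure_univ, mul_one] at h
  rw [unitVol_cells_inter_preimage_dil K hK p Z hZ, h, mul_assoc]

/-- The base interval has disjoint preimages under multiplication by distinct integers in
`[1,G]`. -/
theorem base_interval_disjoint (G γ γ' : ℕ) (hγ : γ ≤ G) (hγ' : γ' ≤ G) (hne : γ ≠ γ')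
    (x : ℝ) (h : dil γ x ∈ Ico (((G + 1 : ℕ) : ℝ) / ((G + 2) ^ 2 : ℕ))
      ((((G + 1 : ℕ) : ℝ) + 1) / ((G + 2) ^ 2 : ℕ)))
    (h' : dil γ' x ∈ Ico (((G + 1 : ℕ) : ℝ) / ((G + 2) ^ 2 : ℕ))
      ((((G + 1 : ℕ) : ℝ) + 1) / ((G + 2) ^ 2 : ℕ))) : False := by
  wlog hlt : γ < γ' generalizing γ γ'
  · exact this γ' γ hγ' hγ hne.symm h' h (by omega)
  have hQ : (0 : ℝ) < (G + 2) ^ 2 := by positivity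
  push_cast at h h'
  obtain ⟨h1, h2⟩ := h
  obtain ⟨h3, h4⟩ := h'
  rw [div_le_iff₀ hQ] at h1 h3
  rw [lt_div_iff₀ hQ] at h2 h4
  set α := dil γ x with hα
  set β := dil γ' x with hβ
  -- Both terms represent `γγ'x` modulo 1, so the difference is an integer; the choice of interval
  -- puts it strictly between 0 and 1.
  have hint : (γ' : ℝ) * α - γ * β = ((γ * ⌊(γ' : ℝ) * x⌋ - γ' * ⌊(γ : ℝ) * x⌋ : ℤ) : ℝ) := by
    rw [hα, hβ, dil, dil, Int.fract, Int.fract]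
    push_cast
    ring
  have hg : (γ : ℝ) ≤ G := by exact_mod_cast hγ
  have hg' : (γ' : ℝ) ≤ G := by exact_mod_cast hγ'
  have hlt' : (γ : ℝ) + 1 ≤ γ' := by exact_mod_cast hlt
  have hγ0 : (0 : ℝ) ≤ γ := by positivity
  have hpos : 0 < ((γ' : ℝ) * α - γ * β) * (G + 2) ^ 2 := by nlinarith
  have hlt1 : ((γ' : ℝ) * α - γ * β) * (G + 2) ^ 2 < 1 * (G + 2) ^ 2 := by
    nlinarith
  have hpos' := (mul_pos_iff_of_pos_right hQ).1 hpos
  have hlt1' := lt_of_mul_lt_mul_right hlt1 hQ.le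
  rw [hint] at hpos' hlt1'
  have e1 : 0 < (γ * ⌊(γ' : ℝ) * x⌋ - γ' * ⌊(γ : ℝ) * x⌋ : ℤ) := by exact_mod_cast hpos'
  have e2 : (γ * ⌊(γ' : ℝ) * x⌋ - γ' * ⌊(γ : ℝ) * x⌋ : ℤ) < 1 := by exact_mod_cast hlt1'
  omega

/-- With a common `K = Qγm`, the events for different `γ` all become conditions on `⌊Kx⌋`, the form
in which independence is exact. Dividing by `m` recovers `⌊Qγx⌋`, whose residue modulo `Q` locates
the fractional part of `γx`. -/
theorem dil_mem_grid_iff (Q a γ m : ℕ) (ha : a < Q) (hm : 1 ≤ m) (x : ℝ) :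
    dil γ x ∈ Ico ((a : ℝ) / Q) ((a + 1) / Q) ↔
      ⌊((Q * γ * m : ℕ) : ℝ) * x⌋ / (m : ℤ) % (Q : ℤ) = a := by
  have hQ : (0 : ℝ) < Q := by exact_mod_cast (by omega : 0 < Q)
  have hm0 : (0 : ℝ) < m := by exact_mod_cast hm
  have h1 : ⌊((Q * γ * m : ℕ) : ℝ) * x⌋ / (m : ℤ) = ⌊(Q : ℝ) * (γ * x)⌋ := by
    rw [← Int.floor_div_natCast]
    congr 1
    push_cast
    field_simp
  have h2 : ⌊(Q : ℝ) * (γ * x)⌋ = ⌊(Q : ℝ) * dil γ x⌋ + Q * ⌊(γ : ℝ) * x⌋ := by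
    have : (Q : ℝ) * (γ * x) = (Q : ℝ) * dil γ x + ((Q * ⌊(γ : ℝ) * x⌋ : ℤ) : ℝ) := by
      rw [dil, Int.fract]; push_cast; ring
    rw [this, Int.floor_add_intCast]
  have h3 : 0 ≤ ⌊(Q : ℝ) * dil γ x⌋ :=
    Int.floor_nonneg.2 (mul_nonneg hQ.le (Int.fract_nonneg _))
  have h4 : ⌊(Q : ℝ) * dil γ x⌋ < Q := by
    rw [Int.floor_lt]
    have : dil γ x < 1 := Int.fract_lt_one _
    push_cast
    nlinarith
  rw [h1, h2, Int.add_mul_emod_self_left, Int.emod_eq_of_lt h3 h4, Int.floor_eq_iff, mem_Ico,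
    div_le_iff₀ hQ, lt_div_iff₀ hQ]
  push_cast
  rw [mul_comm (Q : ℝ)]

/-! ### Failure of the weak type inequality. -/

/-- For some `N ≥ N₀`, at least half of the points `nx`, `n ∈ S_N`, lie in `F`. -/
def HalfVisits (S : Set ℕ) (N₀ : ℕ) (F : Set ℝ) (x : ℝ) : Prop :=
  ∃ N, N₀ ≤ N ∧ 0 < (truncSet S N).card ∧ ∃ D ⊆ truncSet S N,
    (truncSet S N).card ≤ 2 * D.card ∧ ∀ n ∈ D, 0 < n ∧ dil n x ∈ F

theorem HalfVisits.mono {S : Set ℕ} {N₀ : ℕ} {F F' : Set ℝ} {x : ℝ} (h : HalfVisits S N₀ F x)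
    (hF : F ⊆ F') : HalfVisits S N₀ F' x := by
  obtain ⟨N, hN, h0, D, hD, hc, hDF⟩ := h
  exact ⟨N, hN, h0, D, hD, hc, fun n hn => ⟨(hDF n hn).1, hF (hDF n hn).2⟩⟩

theorem HalfVisits.of_dil {S : Set ℕ} {N₀ K : ℕ} {F : Set ℝ} {x : ℝ}
    (h : HalfVisits S N₀ F (dil K x)) : HalfVisits S N₀ (dil K ⁻¹' F) x := by
  obtain ⟨N, hN, h0, D, hD, hc, hDF⟩ := h
  refine ⟨N, hN, h0, D, hD, hc, fun n hn => ⟨(hDF n hn).1, ?_⟩⟩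
  rw [mem_preimage, dil_comm]
  exact (hDF n hn).2

/-- The maximal operator of the averages fails the weak type `(1,1)` inequality with any
constant `C`. -/
theorem exists_weak_type_failure (S : Set ℕ) (hS : S.Infinite)
    (hgrow : ∀ (d : ℕ) (c : ℝ), ∃ n : ℕ, 1 ≤ n ∧ c * (n : ℝ) ^ d < (truncSet S (2 ^ n)).card)
    (C N₀ : ℕ) :
    ∃ (K : ℕ) (p : Set ℤ) (E : Set ℝ), 1 ≤ K ∧ MeasurableSet E ∧
      0 < unitVol {x : ℝ | ⌊(K : ℝ) * x⌋ ∈ p} ∧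
      C * unitVol E ≤ unitVol {x : ℝ | ⌊(K : ℝ) * x⌋ ∈ p} ∧
      ∀ x : ℝ, ⌊(K : ℝ) * x⌋ ∈ p → HalfVisits S N₀ E x := by
  classical
  obtain ⟨n₀, hn₀⟩ := hS.nonempty
  have hmono : Monotone fun k => (truncSet S (2 ^ k)).card := fun a b hab =>
    Finset.card_le_card fun x hx => by
      rw [mem_truncSet] at hx ⊢
      exact ⟨hx.1, hx.2.trans (Nat.pow_le_pow_right (by norm_num) hab)⟩
  -- With `5C + 1` cells, `|K| |E| < 5|X|` gives `C|E| ≤ |X|`; the extra cell keeps `K` nonempty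
  -- when `C = 0`. The threshold forces `N ≥ N₀` and `n₀ ∈ S_N`.
  obtain ⟨r, Ks, hKs, hdouble⟩ := exists_doubling_cells (fun k => (truncSet S (2 ^ k)).card) hmono
    hgrow (5 * C + 1) (max N₀ n₀)
  set w := 2 ^ r with hw
  obtain ⟨X, E, hXpos, hEpos, hXE, hdiv⟩ := exists_division_sets w Nat.one_le_two_pow Ks
    (Finset.card_pos.1 (by omega))
  set G := X.sup id with hG
  have hGle : ∀ γ ∈ X, γ ≤ G := fun γ h => Finset.le_sup (f := id) h
  set Q := (G + 2) ^ 2 with hQ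
  have haQ : G + 1 < Q := by rw [hQ]; nlinarith
  set A : Set ℝ := Ico (((G + 1 : ℕ) : ℝ) / (Q : ℕ)) ((((G + 1 : ℕ) : ℝ) + 1) / (Q : ℕ)) with hA
  have hAm : MeasurableSet A := measurableSet_Ico
  have hQ0 : (0 : ℝ) < Q := by exact_mod_cast (by omega : 0 < Q)
  have hApos : 0 < unitVol A := by
    have hsub : A ⊆ Ico 0 1 := by
      refine Ico_subset_Ico (by positivity) ?_
      rw [div_le_one hQ0]
      exact_mod_cast haQ
    rw [unitVol, Measure.restrict_apply hAm, inter_eq_left.2 hsub, hA, Real.volume_Ico,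
      ENNReal.ofReal_pos, ← sub_div]
    simpa using hQ0
  set K := Q * ∏ γ ∈ X, γ with hK
  have hP : 0 < ∏ γ ∈ X, γ := Finset.prod_pos hXpos
  set p : Set ℤ := {z | ∃ γ ∈ X, z / ((∏ γ ∈ X.erase γ, γ : ℕ) : ℤ) % (Q : ℤ) = ((G + 1 : ℕ) : ℤ)}
    with hp
  have hpiff : ∀ x : ℝ, ⌊(K : ℝ) * x⌋ ∈ p ↔ ∃ γ ∈ X, dil γ x ∈ A := by
    intro x
    simp only [hp, mem_ofPred_eq]
    refine exists_congr fun γ => and_congr_right fun hγ => ?_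
    rw [hA, dil_mem_grid_iff Q (G + 1) γ (∏ γ ∈ X.erase γ, γ) haQ
      (Finset.prod_pos fun i hi => hXpos i (Finset.mem_of_mem_erase hi)), mul_assoc,
      Finset.mul_prod_erase X (fun γ => γ) hγ]
  have hpset : {x : ℝ | ⌊(K : ℝ) * x⌋ ∈ p} = ⋃ γ ∈ X, dil γ ⁻¹' A := by
    ext x
    simp [hpiff x]
  have hXvol : unitVol {x : ℝ | ⌊(K : ℝ) * x⌋ ∈ p} = X.card * unitVol A := by
    rw [hpset, measure_biUnion_finset]
    · rw [Finset.sum_congr rfl fun γ hγ => unitVol_preimage_dil γ (hXpos γ hγ) A hAm]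
      simp
    · intro γ hγ γ' hγ' hne
      rw [Function.onFun, Set.disjoint_left]
      intro x hx hx'
      exact base_interval_disjoint G γ γ' (hGle γ hγ) (hGle γ' hγ') hne x hx hx'
    · exact fun γ _ => measurable_dil γ hAm
  have hEvol : unitVol (⋃ δ ∈ E, dil δ ⁻¹' A) ≤ E.card * unitVol A := by
    refine (measure_biUnion_finset_le _ _).trans ?_
    rw [Finset.sum_congr rfl fun δ hδ => unitVol_preimage_dil δ (hEpos δ hδ) A hAm]
    simp
  refine ⟨K, p, ⋃ δ ∈ E, dil δ ⁻¹' A, Nat.mul_pos (by omega) hP,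
    Finset.measurableSet_biUnion _ fun δ _ => measurable_dil δ hAm, ?_, ?_, ?_⟩
  · rw [hXvol]
    have : X.card ≠ 0 := by omega
    exact ENNReal.mul_pos (by exact_mod_cast this) hApos.ne'
  · rw [hXvol]
    have h1 : C * E.card ≤ X.card := by
      rw [hKs] at hXE
      nlinarith
    calc (C : ENNReal) * unitVol (⋃ δ ∈ E, dil δ ⁻¹' A)
        ≤ C * (E.card * unitVol A) := by gcongr
      _ = ((C * E.card : ℕ) : ENNReal) * unitVol A := by push_cast; ring
      _ ≤ _ := by gcongr
  · intro x hx
    obtain ⟨γ, hγ, hxA⟩ := (hpiff x).1 hx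
    obtain ⟨k, hk, hkdiv⟩ := hdiv γ hγ
    obtain ⟨hT, hd⟩ := hdouble k hk
    have hlt2 : ∀ m : ℕ, m < 2 ^ m := fun m => Nat.lt_two_pow_self
    have hkk : k * w ≤ (k + 1) * w := Nat.mul_le_mul_right _ (Nat.le_succ k)
    have hpow : 2 ^ (k * w) ≤ 2 ^ ((k + 1) * w) := Nat.pow_le_pow_right (by norm_num) hkk
    have hbig : max N₀ n₀ ≤ 2 ^ ((k + 1) * w) := (hT.trans hkk).trans (hlt2 _).le
    refine ⟨2 ^ ((k + 1) * w), (le_max_left _ _).trans hbig,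
      Finset.card_pos.2 ⟨n₀, mem_truncSet.2 ⟨hn₀, (le_max_right _ _).trans hbig⟩⟩,
      truncSet S (2 ^ ((k + 1) * w)) \ truncSet S (2 ^ (k * w)), Finset.sdiff_subset, ?_, ?_⟩
    · have := Finset.le_card_sdiff (truncSet S (2 ^ (k * w))) (truncSet S (2 ^ ((k + 1) * w)))
      omega
    · intro n hn
      rw [Finset.mem_sdiff, mem_truncSet, mem_truncSet] at hn
      have hn1 : 2 ^ (k * w) < n := by
        by_contra! h
        exact hn.2 ⟨hn.1.1, h⟩
      obtain ⟨hnγ, hE⟩ := hkdiv n hn1 hn.1.2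
      refine ⟨Nat.zero_lt_of_lt hn1, mem_biUnion hE ?_⟩
      -- `(γ / n) · nx = γx` modulo 1.
      rw [mem_preimage, dil_dil, Nat.div_mul_cancel hnγ]
      exact hxA

/-! ### Covering the circle by independent copies. -/

/-- Independent copies of a set on which averages are large exhaust the unit interval. -/
theorem exists_iterated_cover (S : Set ℕ) (N₀ K : ℕ) (p : Set ℤ) (E : Set ℝ) (hK : 1 ≤ K)
    (hE : MeasurableSet E) (hx : ∀ x : ℝ, ⌊(K : ℝ) * x⌋ ∈ p → HalfVisits S N₀ E x) (s : ℕ) :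
    ∃ F W : Set ℝ, MeasurableSet F ∧ MeasurableSet W ∧ unitVol F ≤ s * unitVol E ∧
      unitVol W = (1 - unitVol {x : ℝ | ⌊(K : ℝ) * x⌋ ∈ p}) ^ s ∧
      ∀ x ∉ W, HalfVisits S N₀ F x := by
  induction s with
  | zero => exact ⟨∅, univ, MeasurableSet.empty, MeasurableSet.univ, by simp, by simp, by simp⟩
  | succ s ih =>
    obtain ⟨F, W, hF, hW, hFv, hWv, hFW⟩ := ih
    -- A point is bad only if its cell is bad and `Kx` was bad before; these events are independent.
    refine ⟨E ∪ dil K ⁻¹' F, {x : ℝ | ⌊(K : ℝ) * x⌋ ∈ pᶜ} ∩ dil K ⁻¹' W,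
      hE.union (measurable_dil K hF), (measurableSet_cells K _).inter (measurable_dil K hW),
      ?_, ?_, ?_⟩
    · refine (measure_union_le _ _).trans ?_
      rw [unitVol_preimage_dil K hK F hF]
      push_cast
      rw [add_mul, one_mul, add_comm]
      gcongr
    · rw [unitVol_cells_indep K hK _ W hW, hWv, pow_succ', ← prob_compl_eq_one_sub
        (measurableSet_cells K p)]
      rfl
    · intro x hxW
      by_cases h : ⌊(K : ℝ) * x⌋ ∈ p
      · exact (hx x h).mono subset_union_left
      · have : dil K x ∉ W := fun h' => hxW ⟨h, h'⟩
        exact (hFW _ this).of_dil.mono subset_union_right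

/-- Sets of arbitrarily small measure that are visited half of the time, at some late stage, from
all points outside a small exceptional set. -/
theorem exists_small_set_halfVisits (S : Set ℕ) (hS : S.Infinite)
    (hgrow : ∀ (d : ℕ) (c : ℝ), ∃ n : ℕ, 1 ≤ n ∧ c * (n : ℝ) ^ d < (truncSet S (2 ^ n)).card)
    (j : ℕ) :
    ∃ F W : Set ℝ, MeasurableSet F ∧ MeasurableSet W ∧
      unitVol F ≤ ENNReal.ofReal ((1 / 4) ^ j) ∧ unitVol W ≤ ENNReal.ofReal ((1 / 2) ^ j) ∧
      ∀ x ∉ W, HalfVisits S j F x := by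
  -- The constant is tuned to `s ≤ (j + 1) / κ` copies: their total measure is then at most
  -- `4^{-j}`, while `(1 - κ)^s ≤ e^{-j}`.
  obtain ⟨K, p, E, hK, hE, hpos, hCE, hx⟩ :=
    exists_weak_type_failure S hS hgrow ((j + 1) * 4 ^ j) j
  set κ' := unitVol {x : ℝ | ⌊(K : ℝ) * x⌋ ∈ p} with hκ'
  have hκ'1 : κ' ≤ 1 := prob_le_one
  have hκ'top : κ' ≠ ⊤ := measure_ne_top _ _
  set κ := κ'.toReal with hκ
  have hκ0 : 0 < κ := ENNReal.toReal_pos hpos.ne' hκ'top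
  have hκ1 : κ ≤ 1 := by
    have := ENNReal.toReal_mono ENNReal.one_ne_top hκ'1
    simpa using this
  set s := ⌈(j : ℝ) / κ⌉₊ with hs
  have hs1 : (j : ℝ) ≤ s * κ := by
    rw [← div_le_iff₀ hκ0]; exact Nat.le_ceil _
  have hs2 : s * κ ≤ j + 1 := by
    have h := (Nat.ceil_lt_add_one (show 0 ≤ (j : ℝ) / κ by positivity)).le
    have : (s : ℝ) * κ ≤ (j / κ + 1) * κ := by gcongr
    rw [add_mul, div_mul_cancel₀ _ hκ0.ne'] at this
    linarith
  obtain ⟨F, W, hF, hW, hFv, hWv, hFW⟩ := exists_iterated_cover S j K p E hK hE hx s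
  refine ⟨F, W, hF, hW, hFv.trans ?_, ?_, hFW⟩
  · have hEtop : unitVol E ≠ ⊤ := measure_ne_top _ _
    set e := (unitVol E).toReal with he
    have h1 : ((j + 1) * 4 ^ j : ℝ) * e ≤ κ := by
      have := ENNReal.toReal_mono hκ'top hCE
      rw [ENNReal.toReal_mul, ENNReal.toReal_natCast] at this
      exact_mod_cast this
    have h2 : (s : ENNReal) * unitVol E = ENNReal.ofReal (s * e) := by
      rw [ENNReal.ofReal_mul (by positivity), ENNReal.ofReal_natCast, ENNReal.ofReal_toReal hEtop]
    rw [h2]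
    refine ENNReal.ofReal_le_ofReal ?_
    rw [one_div, inv_pow, ← one_div, le_div_iff₀ (by positivity)]
    have h3 : (s : ℝ) * (((j + 1) * 4 ^ j : ℝ) * e) ≤ s * κ := by gcongr
    have h4 : (s * e * 4 ^ j) * (j + 1 : ℝ) ≤ 1 * (j + 1) := by linarith
    exact le_of_mul_le_mul_right h4 (by positivity)
  · have h1 : 1 - κ' = ENNReal.ofReal (1 - κ) := by
      rw [ENNReal.ofReal_sub _ hκ0.le, ENNReal.ofReal_one, ENNReal.ofReal_toReal hκ'top]
    rw [hWv, h1, ← ENNReal.ofReal_pow (by linarith)]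
    refine ENNReal.ofReal_le_ofReal ?_
    have h2 : 1 - κ ≤ Real.exp (-κ) := by linarith [Real.add_one_le_exp (-κ)]
    calc (1 - κ) ^ s ≤ Real.exp (-κ) ^ s := pow_le_pow_left₀ (by linarith) h2 s
      _ = Real.exp (-(s * κ)) := by rw [← Real.exp_nat_mul]; ring_nf
      _ ≤ Real.exp (-(j : ℝ)) := Real.exp_le_exp.2 (by linarith)
      _ = Real.exp (-1) ^ j := by rw [← Real.exp_nat_mul]; ring_nf
      _ ≤ (1 / 2) ^ j := by
          refine pow_le_pow_left₀ (Real.exp_pos _).le ?_ j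
          rw [Real.exp_neg, one_div]
          exact inv_anti₀ (by norm_num) (by linarith [Real.exp_one_gt_d9])

/-! ### Assembling the function. -/

theorem tsum_ofReal_half_pow_ne_top : (∑' j : ℕ, ENNReal.ofReal ((1 / 2 : ℝ) ^ j)) ≠ ⊤ := by
  rw [← ENNReal.ofReal_tsum_of_nonneg (fun j => by positivity)
    (summable_geometric_of_lt_one (by norm_num) (by norm_num))]
  exact ENNReal.ofReal_ne_top

theorem mainTheorem12 (S : Set ℕ) (hS : S.Infinite)
    (hgrowth : ∀ k : ℕ,
      limsup (fun N : ℕ =>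
        ((((truncSet S N).card : ℝ) / (Real.log (N : ℝ)) ^ k : ℝ) : EReal)) atTop = ⊤) :
    ∃ f : ℝ → ℝ, IntegrableOn f (Set.Ico (0 : ℝ) 1) volume ∧
      ∀ᵐ x ∂(volume.restrict (Set.Ico (0 : ℝ) 1)),
        limsup (fun N : ℕ => ((khinchinAvg S f N x : ℝ) : EReal)) atTop = ⊤ := by
  choose F W hF hW hFv hWv hFW using
    exists_small_set_halfVisits S hS (truncSet_two_pow_growth S hgrowth)
  set φ : ℝ → ENNReal := fun x => ∑' j, (F j).indicator (fun _ => (2 : ENNReal) ^ j) x with hφ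
  have hmj : ∀ j, Measurable ((F j).indicator fun _ : ℝ => (2 : ENNReal) ^ j) :=
    fun j => measurable_const.indicator (hF j)
  have hφm : Measurable φ := Measurable.tsum hmj
  have hφint : ∫⁻ x, φ x ∂unitVol ≠ ⊤ := by
    rw [hφ, lintegral_tsum fun j => (hmj j).aemeasurable]
    refine ne_top_of_le_ne_top tsum_ofReal_half_pow_ne_top (ENNReal.tsum_le_tsum fun j => ?_)
    rw [lintegral_indicator_const (hF j)]
    calc (2 : ENNReal) ^ j * unitVol (F j)
        ≤ ENNReal.ofReal (2 ^ j) * ENNReal.ofReal ((1 / 4) ^ j) := by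
          rw [ENNReal.ofReal_pow (by norm_num), ENNReal.ofReal_ofNat]
          gcongr
          exact hFv j
      _ = ENNReal.ofReal ((1 / 2) ^ j) := by
          rw [← ENNReal.ofReal_mul (by positivity), ← mul_pow]
          norm_num
  refine ⟨fun x => (φ x).toReal, integrable_toReal_of_lintegral_ne_top hφm.aemeasurable hφint, ?_⟩
  change ∀ᵐ x ∂unitVol, _
  have hfin : ∀ᵐ x ∂unitVol, φ x < ⊤ := ae_lt_top hφm hφint
  -- `toReal` sends `⊤` to 0, so finiteness is needed along the orbit; only `n > 0` preserves the
  -- measure.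
  have hfinall : ∀ᵐ x ∂unitVol, ∀ n : ℕ, 0 < n → φ (dil n x) < ⊤ := by
    rw [ae_all_iff]
    intro n
    by_cases hn : 0 < n
    · have hmp : MeasurePreserving (dil n) unitVol unitVol :=
        ⟨measurable_dil n, Measure.ext fun s hs => by
          rw [Measure.map_apply (measurable_dil n) hs, unitVol_preimage_dil n hn s hs]⟩
      filter_upwards [hmp.quasiMeasurePreserving.ae hfin] with x hx _ using hx
    · exact Eventually.of_forall fun x h => absurd h hn
  have hBC : ∀ᵐ x ∂unitVol, ∀ᶠ j in atTop, x ∉ W j :=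
    ae_eventually_notMem
      (ne_top_of_le_ne_top tsum_ofReal_half_pow_ne_top (ENNReal.tsum_le_tsum hWv))
  filter_upwards [hfinall, hBC] with x hx hxW
  rw [EReal.eq_top_iff_forall_lt]
  intro y
  obtain ⟨j₀, hj₀⟩ := eventually_atTop.1 hxW
  obtain ⟨m, hm⟩ := pow_unbounded_of_one_lt (2 * (|y| + 1)) (one_lt_two : (1 : ℝ) < 2)
  have hfreq : ∃ᶠ N in atTop, ((y + 1 : ℝ) : EReal) ≤
      ((khinchinAvg S (fun x => (φ x).toReal) N x : ℝ) : EReal) := by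
    rw [frequently_atTop]
    intro N₀
    -- `j₀` keeps `x` out of `W j`, `m` makes `2^j / 2` exceed `y + 1`, and `N₀` makes `N` late
    -- enough.
    set j := max (max j₀ m) N₀ with hj
    obtain ⟨N, hN, hcard, D, hD, hDc, hDF⟩ :=
      hFW j x (hj₀ j ((le_max_left _ _).trans (le_max_left _ _)))
    refine ⟨N, (le_max_right _ _).trans hN, EReal.coe_le_coe_iff.2 ?_⟩
    have hval : ∀ n ∈ D, (2 : ℝ) ^ j ≤ (φ (Int.fract ((n : ℝ) * x))).toReal := by
      intro n hn
      obtain ⟨hn0, hnF⟩ := hDF n hn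
      have h1 : (2 : ENNReal) ^ j ≤ φ (dil n x) := by
        have := ENNReal.le_tsum (f := fun i => (F i).indicator (fun _ => (2 : ENNReal) ^ i)
          (dil n x)) j
        simpa only [indicator_of_mem hnF] using this
      have := ENNReal.toReal_mono (hx n hn0).ne h1
      simpa [dil] using this
    have hsum : (D.card : ℝ) * 2 ^ j ≤
        ∑ n ∈ truncSet S N, (φ (Int.fract ((n : ℝ) * x))).toReal := by
      rw [← nsmul_eq_mul]
      exact (Finset.card_nsmul_le_sum _ _ _ hval).trans
        (Finset.sum_le_sum_of_subset_of_nonneg hD fun _ _ _ => ENNReal.toReal_nonneg)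
    have hc0 : (0 : ℝ) < (truncSet S N).card := by exact_mod_cast hcard
    have hDc' : ((truncSet S N).card : ℝ) ≤ 2 * D.card := by exact_mod_cast hDc
    have hjm : (2 : ℝ) ^ m ≤ 2 ^ j :=
      pow_le_pow_right₀ one_le_two ((le_max_right _ _).trans (le_max_left _ _))
    rw [khinchinAvg, one_div, ← div_eq_inv_mul, le_div_iff₀ hc0]
    have hy : y + 1 ≤ 2 ^ j / 2 := by linarith [le_abs_self y]
    calc (y + 1) * (truncSet S N).card ≤ 2 ^ j / 2 * (truncSet S N).card := by gcongr
      _ ≤ 2 ^ j / 2 * (2 * D.card) := by gcongr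
      _ = D.card * 2 ^ j := by ring
      _ ≤ _ := hsum
  refine lt_of_lt_of_le ?_ (le_limsup_of_frequently_le hfreq)
  exact EReal.coe_lt_coe_iff.2 (by linarith)
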